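/- Let $k$ be a perfect field, $Z$ a smooth projective variety over $k$ of dimension $d$ with an ample line bundle $H$, and $G$ a connected split reductive group over $k$ with Lie algebra $\mathfrak g$. A \emph{$G$-Higgs bundle} on $Z$ is a pair $(V,\theta)$ of a principal $G$-bundle $V$ (étale-locally trivial) and a section $\theta\in H^0(Z,V(\mathfrak g)\otimes\Omega_Z)$ with $\theta\wedge\theta=0$. For a $k$-scheme $C$, a \emph{$C$-family} of $G$-Higgs bundles is a pair $(V_C,\theta_C)$ of a $G$-bundle on $Z\times_k C$ and a section $\theta_C$ of $V_C(\mathfrak g)\otimes\Omega_{Z\times C/C}$ with $\theta_C\wedge\theta_C=0$. A $G$-Higgs bundle over a field is \emph{$R$-stable} if for every proper parabolic subgroup $P\subset G$, every reduction of structure group $V_\sigma$ of $V$ to $P$ such that $\theta$ comes from $V_\sigma(\mathfrak p)\otimes\Omega_Z$, and every nontrivial antidominant character $\chi:P\to\mathbb G_m$ that is trivial on the center of $P$, the line bundle $\chi_*V_\sigma$ has positive degree with respect to $H$. A family is called $R$-stable if its fibres at all geometric points of $C$ are $R$-stable. A $G$-Higgs bundle $(V,\theta)$ on $Z$ is \emph{rigid}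 if it is $R$-stable after base change to every algebraically closed extension of $k$, and if there are no positive-dimensional geometrically irreducible $k$-scheme $C$ of finite type, $R$-stable $C$-family $(V_C,\theta_C)$ of $G$-Higgs bundles, finite extension $k'/k$ and points $c_0,c_1\in C(k')$ such that $(V_C,\theta_C)_{c_0}\cong(V,\theta)_{k'}$, while $(V_C,\theta_C)_{c_0}$ and $(V_C,\theta_C)_{c_1}$ are not isomorphic over $\bar k$. Then every rigid $G$-Higgs bundle $(V,\theta)$ on $Z$ has nilpotent Higgs field: for every trivialization of $V$ over a (étale) chart $U\to Z$ and every representation $\rho:G\to \mathrm{GL}_N$, the matrices $d\rho(\theta(\partial))$, for $\partial$ a section of $T_Z$ over $U$, lie in a nilpotent Lie algebra consisting of nilpotent matrices over $\mathcal O(U)$. -/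

import Mathlib

open CategoryTheory MonoidalCategory CartesianMonoidalCategory MonObj AlgebraicGeometry Limits
open Filter Topology

universe u

noncomputable section

namespace GHiggs

/-! ### Schemes over a field and their points with values in algebras -/

/-- Schemes over the field `k`. The monoidal product `⊗` is the fibre product over `k`. -/
abbrev Sch (k : Type u) [Field k] : Type (u + 1) := Over (Spec (CommRingCat.of k))

/-- The spectrum of a `k`-algebra, as a scheme over `k`. -/
abbrev specOver (k : Type u) [Field k] (R : Type u) [CommRing R] [Algebra k R] : Sch k :=
  Over.mk (Spec.map (CommRingCat.ofHom (algebraMap k R)))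

/-- The points of a `k`-scheme with values in a `k`-algebra. If the scheme is a group scheme,
these form a group. -/
abbrev Pt {k : Type u} [Field k] (R : Type u) [CommRing R] [Algebra k R] (X : Sch k) : Type u :=
  specOver k R ⟶ X

/-- Functoriality of `specOver`. -/
def specOverMap {k : Type u} [Field k] {R S : Type u} [CommRing R] [Algebra k R]
    [CommRing S] [Algebra k S] (f : R →ₐ[k] S) : specOver k S ⟶ specOver k R :=
  Over.homMk (Spec.map (CommRingCat.ofHom f.toRingHom)) (by
    simp [← Spec.map_comp, ← CommRingCat.ofHom_comp])

/-- The map `X(R) → X(S)` induced by a map of `k`-algebras `R → S`. -/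
abbrev Pt.map {k : Type u} [Field k] {R S : Type u} [CommRing R] [Algebra k R]
    [CommRing S] [Algebra k S] {X : Sch k} (f : R →ₐ[k] S) (x : Pt R X) : Pt S X :=
  specOverMap f ≫ x

/-- The value of a global function at an `R`-valued point. -/
def Pt.eval {k : Type u} [Field k] {R : Type u} [CommRing R] [Algebra k R] {X : Sch k}
    (x : Pt R X) (f : Γ(X.left, ⊤)) : R :=
  (Scheme.ΓSpecIso (CommRingCat.of R)).hom (x.left.appTop f)

/-! ### Tori -/

/-- The split torus of rank `r`, that is, the spectrum of the group algebra of `ℤ ^ r`. -/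
abbrev splitTorus (k : Type u) [Field k] (r : ℕ) : Sch k :=
  (Spec (CommRingCat.of (MonoidAlgebra k (Multiplicative (Fin r → ℤ))))).asOver
    (Spec (CommRingCat.of k))

/-- The multiplicative group, the spectrum of the Laurent polynomial ring. -/
abbrev Gm (k : Type u) [Field k] : Sch k :=
  (Spec (CommRingCat.of (LaurentPolynomial k))).asOver (Spec (CommRingCat.of k))

/-- The unit of `R` that is given by an `R`-valued point of the multiplicative group. -/
def Gm.coord {k : Type u} [Field k] {R : Type u} [CommRing R] [Algebra k R]
    (s : Pt R (Gm k)) : R :=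
  Pt.eval s ((Scheme.ΓSpecIso (CommRingCat.of (LaurentPolynomial k))).inv
    (LaurentPolynomial.T 1 : LaurentPolynomial k))

/-- Base change to the algebraic closure. -/
abbrev geom {k : Type u} [Field k] (X : Sch k) : Sch (AlgebraicClosure k) :=
  (Over.pullback (Spec.map (CommRingCat.ofHom (algebraMap k (AlgebraicClosure k))))).obj X

instance {k : Type u} [Field k] (G : Sch k) [GrpObj G] : GrpObj (geom G) :=
  Functor.grpObjObj

/-- Tori: group schemes that become split tori over the algebraic closure. -/
def IsTorus {k : Type u} [Field k] (T : Sch k) [GrpObj T] : Prop :=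
  ∃ (r : ℕ) (e : geom T ≅ splitTorus (AlgebraicClosure k) r), IsMonHom e.hom

/-! ### Representations and reductive groups -/

/-- A representation `H → GL_N` of a group scheme, given on points. -/
structure Rep {k : Type u} [Field k] (H : Sch k) [GrpObj H] (N : ℕ) where
  toHom : ∀ (R : Type u) [CommRing R] [Algebra k R], Pt R H →* Matrix.GeneralLinearGroup (Fin N) R
  natural : ∀ (R S : Type u) [CommRing R] [Algebra k R] [CommRing S] [Algebra k S]
    (f : R →ₐ[k] S) (h : Pt R H),
    toHom S (Pt.map f h) = Matrix.GeneralLinearGroup.map f.toRingHom (toHom R h)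

/-- Unipotent group schemes: those with a faithful representation by upper triangular matrices
all of whose diagonal entries are `1`. -/
def IsUnipotent {k : Type u} [Field k] (U : Sch k) [GrpObj U] : Prop :=
  ∃ (N : ℕ) (ρ : Rep U N), ∀ (R : Type u) [CommRing R] [Algebra k R],
    Function.Injective (ρ.toHom R) ∧
    ∀ (x : Pt R U) (i : Fin N), (ρ.toHom R x).1 i i = 1 ∧ ∀ j < i, (ρ.toHom R x).1 i j = 0

/-- Connected reductive groups over `k`: smooth connected affine group schemes over `k` whose base
change to the algebraic closure has no nontrivial smooth connected unipotent normal subgroup. -/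
structure IsReductive {k : Type u} [Field k] (G : Sch k) [GrpObj G] : Prop where
  affine : IsAffine G.left
  smooth : Smooth G.hom
  connected : GeometricallyConnected G.hom
  radical : ∀ (U : Sch (AlgebraicClosure k)) [GrpObj U] (i : U ⟶ geom G),
    IsClosedImmersion i.left → IsMonHom.Normal i → Smooth U.hom → ConnectedSpace U.left →
    IsUnipotent U → IsIso U.hom

/-- A group scheme is split if one of its maximal tori is a split torus. -/
def IsSplit {k : Type u} [Field k] (G : Sch k) [GrpObj G] : Prop :=
  ∃ (r : ℕ) (i : splitTorus k r ⟶ G), IsMonHom i ∧ IsClosedImmersion i.left ∧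
    ∀ (T : Sch k) [GrpObj T] (i' : T ⟶ G) (j : splitTorus k r ⟶ T),
      IsTorus T → IsMonHom i' → IsClosedImmersion i'.left → j ≫ i' = i → IsIso j

/-! ### Principal bundles -/

/-- `π : V ⟶ B` is a principal `G`-bundle with respect to the right action `act`: the action is
simply transitive on the fibres of `π` (on points with values in every scheme), and `π` has
sections étale-locally on `B`. -/
structure IsTorsor {k : Type u} [Field k] {G V B : Sch k} [GrpObj G]
    (act : V ⊗ G ⟶ V) (π : V ⟶ B) : Prop where
  act_one : ∀ (T : Sch k) (v : T ⟶ V), lift v (1 : T ⟶ G) ≫ act = v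
  act_mul : ∀ (T : Sch k) (v : T ⟶ V) (g h : T ⟶ G),
    lift (lift v g ≫ act) h ≫ act = lift v (g * h) ≫ act
  act_proj : ∀ (T : Sch k) (v : T ⟶ V) (g : T ⟶ G), (lift v g ≫ act) ≫ π = v ≫ π
  simply_transitive : ∀ (T : Sch k) (v w : T ⟶ V), v ≫ π = w ≫ π →
    ∃! g : T ⟶ G, lift v g ≫ act = w
  locally_trivial : ∃ (U : Sch k) (p : U ⟶ B) (s : U ⟶ V),
    Etale p.left ∧ Surjective p.left ∧ s ≫ π = p

/-- A parabolic subgroup: a smooth closed subgroup `P` of `G` such that the quotient `G / P` is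
proper, where `G / P` is the base of `G` as a principal `P`-bundle under right multiplication. -/
structure IsParabolic {k : Type u} [Field k] {P G : Sch k} [GrpObj P] [GrpObj G]
    (i : P ⟶ G) : Prop where
  hom : IsMonHom i
  closed : IsClosedImmersion i.left
  smooth : Smooth P.hom
  quotient : ∃ (Q : Sch k) (q : G ⟶ Q), IsProper Q.hom ∧ IsTorsor ((G ◁ i) ≫ μ[G]) q

/-! ### Higgs bundles -/

/-- A split square-zero extension `A` of `R`, so that `A = R ⊕ M` with `M` the kernel of `retr`. -/
structure SqZeroExt {k : Type u} [Field k] (R A : Type u) [CommRing R] [Algebra k R]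
    [CommRing A] [Algebra k A] where
  incl : R →ₐ[k] A
  retr : A →ₐ[k] R
  retr_incl : ∀ r, retr (incl r) = r
  sq_zero : ∀ a b, retr a = 0 → retr b = 0 → a * b = 0

/-- The dual numbers `R[ε]` as an extension of `R`. -/
def SqZeroExt.dual (k : Type u) [Field k] (R : Type u) [CommRing R] [Algebra k R] :
    SqZeroExt (k := k) R (DualNumber R) where
  incl := TrivSqZeroExt.inlAlgHom k R R
  retr := TrivSqZeroExt.fstHom k R R
  retr_incl r := by simp
  sq_zero a b ha hb := by
    ext
    · have ha' : a.fst = 0 := ha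
      simp [ha']
    · have ha' : a.fst = 0 := ha
      have hb' : b.fst = 0 := hb
      simp [ha', hb']

/-- A family of `G`-Higgs bundles on `Z` with parameter scheme `C`: a principal `G`-bundle `V` on
`Z × C` with a section `θ` of `V(𝔤) ⊗ Ω_{(Z × C) / C}` such that `θ ∧ θ = 0`.

The section is given on points. Let `A = R ⊕ M` be a split square-zero extension. For a point
`v ∈ V(R)` over `z ∈ Z(R)`, the points `τ ∈ Z(A)` that restrict to `z` are the elements of
`Hom(z^*Ω_Z, M)`, the kernel of `G(A) → G(R)` is `𝔤 ⊗ M`, and `θ` maps `τ` to the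
contraction of the Higgs field at `v` with `τ`. Naturality in `A` contains linearity in `τ`; the
universal case `M = z^*Ω_Z` gives back the section. The last field says that the values of `θ` at
`v` have trivial Lie brackets, for the group commutator in `G(A₁ ⊗_R A₂)` of elements of
`𝔤 ⊗ M₁` and `𝔤 ⊗ M₂` is their bracket in `𝔤 ⊗ M₁ ⊗ M₂`. -/
structure HiggsFamily {k : Type u} [Field k] (G Z C : Sch k) [GrpObj G] where
  tot : Sch k
  proj : tot ⟶ Z ⊗ C
  act : tot ⊗ G ⟶ tot
  torsor : IsTorsor act proj
  θ : ∀ {R A : Type u} [CommRing R] [Algebra k R] [CommRing A] [Algebra k A]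
    (e : SqZeroExt (k := k) R A) (v : Pt R tot) (τ : Pt A Z),
    Pt.map e.retr τ = v ≫ proj ≫ fst Z C → Pt A G
  θ_lie : ∀ {R A : Type u} [CommRing R] [Algebra k R] [CommRing A] [Algebra k A]
    (e : SqZeroExt (k := k) R A) (v : Pt R tot) (τ : Pt A Z)
    (h : Pt.map e.retr τ = v ≫ proj ≫ fst Z C), Pt.map e.retr (θ e v τ h) = 1
  θ_natural : ∀ {R A R' A' : Type u} [CommRing R] [Algebra k R] [CommRing A] [Algebra k A]
    [CommRing R'] [Algebra k R'] [CommRing A'] [Algebra k A']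
    (e : SqZeroExt (k := k) R A) (e' : SqZeroExt (k := k) R' A')
    (f : R →ₐ[k] R') (F : A →ₐ[k] A'),
    F.comp e.incl = e'.incl.comp f → e'.retr.comp F = f.comp e.retr →
    ∀ (v : Pt R tot) (τ : Pt A Z) (h : Pt.map e.retr τ = v ≫ proj ≫ fst Z C)
      (h' : Pt.map e'.retr (Pt.map F τ) = Pt.map f v ≫ proj ≫ fst Z C),
      θ e' (Pt.map f v) (Pt.map F τ) h' = Pt.map F (θ e v τ h)
  θ_equivariant : ∀ {R A : Type u} [CommRing R] [Algebra k R] [CommRing A] [Algebra k A]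
    (e : SqZeroExt (k := k) R A) (v : Pt R tot) (g : Pt R G) (τ : Pt A Z)
    (h : Pt.map e.retr τ = v ≫ proj ≫ fst Z C)
    (h' : Pt.map e.retr τ = (lift v g ≫ act) ≫ proj ≫ fst Z C),
    θ e (lift v g ≫ act) τ h' = (Pt.map e.incl g)⁻¹ * θ e v τ h * Pt.map e.incl g
  θ_integrable : ∀ {R A₁ A₂ S : Type u} [CommRing R] [Algebra k R] [CommRing A₁] [Algebra k A₁]
    [CommRing A₂] [Algebra k A₂] [CommRing S] [Algebra k S]
    (e₁ : SqZeroExt (k := k) R A₁) (e₂ : SqZeroExt (k := k) R A₂) (v : Pt R tot)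
    (τ₁ : Pt A₁ Z) (τ₂ : Pt A₂ Z)
    (h₁ : Pt.map e₁.retr τ₁ = v ≫ proj ≫ fst Z C) (h₂ : Pt.map e₂.retr τ₂ = v ≫ proj ≫ fst Z C)
    (f₁ : A₁ →ₐ[k] S) (f₂ : A₂ →ₐ[k] S), f₁.comp e₁.incl = f₂.comp e₂.incl →
    Commute (Pt.map f₁ (θ e₁ v τ₁ h₁)) (Pt.map f₂ (θ e₂ v τ₂ h₂))

/-- A `G`-Higgs bundle on `Z`: a family whose parameter scheme is the point `Spec k`. -/
abbrev HiggsBundle {k : Type u} [Field k] (G Z : Sch k) [GrpObj G] : Type (u + 1) :=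
  HiggsFamily G Z (𝟙_ (Sch k))

/-- `E'` is isomorphic to the pullback of the family `E` along `f : C' ⟶ C`. (An equivariant map
of principal bundles over `Z × C' ⟶ Z × C` identifies the first one with the pullback of the
second one.) -/
def IsPullbackOf {k : Type u} [Field k] {G Z C' C : Sch k} [GrpObj G]
    (E' : HiggsFamily G Z C') (E : HiggsFamily G Z C) (f : C' ⟶ C) : Prop :=
  ∃ φ : E'.tot ⟶ E.tot,
    φ ≫ E.proj = E'.proj ≫ (Z ◁ f) ∧
    E'.act ≫ φ = (φ ▷ G) ≫ E.act ∧
    ∀ {R A : Type u} [CommRing R] [Algebra k R] [CommRing A] [Algebra k A]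
      (e : SqZeroExt (k := k) R A) (v : Pt R E'.tot) (τ : Pt A Z)
      (h' : Pt.map e.retr τ = v ≫ E'.proj ≫ fst Z C')
      (h : Pt.map e.retr τ = (v ≫ φ) ≫ E.proj ≫ fst Z C),
      E.θ e (v ≫ φ) τ h = E'.θ e v τ h'

/-! ### Nilpotent Higgs fields -/

/-- The matrix `dρ(x)` over `R`, for `x` in the kernel of `G(R[ε]) → G(R)`, that is, in `𝔤(R)`: if
`ρ(x) = 1 + ε X`, then `dρ(x) = X`. -/
def Rep.deriv {k : Type u} [Field k] {G : Sch k} [GrpObj G] {N : ℕ} (ρ : Rep G N)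
    {R : Type u} [CommRing R] [Algebra k R] (x : Pt (DualNumber R) G) : Matrix (Fin N) (Fin N) R :=
  (ρ.toHom (DualNumber R) x).1.map TrivSqZeroExt.snd

attribute [local instance] LieRing.ofAssociativeRing in
/-- The Higgs field is nilpotent: in every trivialization `v` of the bundle (over any `R`-valued
point of `Z × C`), its contractions with tangent vectors are contained, in every representation
of `G`, in a nilpotent Lie algebra of nilpotent matrices. -/
def HiggsFamily.IsNilpotent {k : Type u} [Field k] {G Z C : Sch k} [GrpObj G]
    (E : HiggsFamily G Z C) : Prop :=
  ∀ (N : ℕ) (ρ : Rep G N) (R : Type u) [CommRing R] [Algebra k R] (v : Pt R E.tot),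
    ∃ 𝔫 : LieSubalgebra R (Matrix (Fin N) (Fin N) R),
      LieRing.IsNilpotent 𝔫 ∧ (∀ X ∈ 𝔫, _root_.IsNilpotent X) ∧
      ∀ (τ : Pt (DualNumber R) Z)
        (h : Pt.map (SqZeroExt.dual k R).retr τ = v ≫ E.proj ≫ fst Z C),
        ρ.deriv (E.θ (SqZeroExt.dual k R) v τ h) ∈ 𝔫

/-! ### Characters of parabolic subgroups -/

/-- A homomorphism from `SL_2` to a group scheme, given on points. -/
structure SL2Hom {k : Type u} [Field k] (G : Sch k) [GrpObj G] where
  toHom : ∀ (R : Type u) [CommRing R] [Algebra k R],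
    Matrix.SpecialLinearGroup (Fin 2) R →* Pt R G
  natural : ∀ (R S : Type u) [CommRing R] [Algebra k R] [CommRing S] [Algebra k S]
    (f : R →ₐ[k] S) (h : Matrix.SpecialLinearGroup (Fin 2) R),
    toHom S (Matrix.SpecialLinearGroup.map f.toRingHom h) = Pt.map f (toHom R h)

/-- The diagonal matrix with entries `t` and `t⁻¹`. -/
def diagSL2 {R : Type u} [CommRing R] (t : Rˣ) : Matrix.SpecialLinearGroup (Fin 2) R :=
  ⟨!![(t : R), 0; 0, ((t⁻¹ : Rˣ) : R)], by simp [Matrix.det_fin_two]⟩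

/-- A character `χ` of a parabolic subgroup `P` is antidominant if its pairing with every coroot
that is positive with respect to `P` is at most `0`. Here the coroots are the restrictions to the
diagonal torus of homomorphisms `SL_2 → G` that map the upper triangular matrices to `P`. -/
def IsAntidominant {k : Type u} [Field k] {P G : Sch k} [GrpObj P] [GrpObj G]
    (i : P ⟶ G) (χ : P ⟶ Gm k) : Prop :=
  ∀ (φ : SL2Hom G) (n : ℤ),
    (∀ (R : Type u) [CommRing R] [Algebra k R] (b : Matrix.SpecialLinearGroup (Fin 2) R),
      b 1 0 = 0 → ∃ p : Pt R P, p ≫ i = φ.toHom R b) →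
    (∀ (R : Type u) [CommRing R] [Algebra k R] (t : Rˣ) (p : Pt R P),
      p ≫ i = φ.toHom R (diagSL2 t) → Gm.coord (p ≫ χ) = ((t ^ n : Rˣ) : R)) →
    n ≤ 0

/-- The character `χ` is trivial on the center of `P`. -/
def IsTrivialOnCenter {k : Type u} [Field k] {P : Sch k} [GrpObj P] (χ : P ⟶ Gm k) : Prop :=
  ∀ (R : Type u) [CommRing R] [Algebra k R] (z : Pt R P),
    (∀ (S : Type u) [CommRing S] [Algebra k S] (f : R →ₐ[k] S) (p : Pt S P),
      Commute (Pt.map f z) p) → z ≫ χ = 1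

/-! ### Polarizations, degrees and stability -/

/-- A polarization of `Z`: an ample line bundle `H`, given as its frame bundle `W`, a principal
bundle of the multiplicative group. The sections of `H ^ n` are the functions `f` on `W` with
`f(w s) = s ^ (-n) f(w)`. Ampleness says that the affine open sets among the nonvanishing loci of
sections of positive powers of `H` cover `Z`. -/
structure Polarization {k : Type u} [Field k] (Z : Sch k) where
  tot : Sch k
  proj : tot ⟶ Z
  act : tot ⊗ Gm k ⟶ tot
  torsor : IsTorsor act proj
  ample : ∀ w : tot.left, ∃ (n : ℕ) (f : Γ(tot.left, ⊤)), 0 < n ∧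
    (∀ (R : Type u) [CommRing R] [Algebra k R] (x : Pt R tot) (s : Pt R (Gm k)),
      Pt.eval (lift x s ≫ act) f * Gm.coord s ^ n = Pt.eval x f) ∧
    w ∈ tot.left.basicOpen f ∧ IsAffineOpen (tot.left.basicOpen f)

/-- A reduction of the structure group of the underlying bundle of `E` to the subgroup `P`, that
is, a section of `V / P`, given by the corresponding principal `P`-bundle `V_σ` and its
equivariant map to `V`. -/
structure Reduction {k : Type u} [Field k] {P G Z C : Sch k} [GrpObj P] [GrpObj G]
    (i : P ⟶ G) (E : HiggsFamily G Z C) where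
  tot : Sch k
  proj : tot ⟶ Z ⊗ C
  act : tot ⊗ P ⟶ tot
  torsor : IsTorsor act proj
  incl : tot ⟶ E.tot
  incl_proj : incl ≫ E.proj = proj
  incl_act : act ≫ incl = (incl ⊗ₘ i) ≫ E.act

/-- The reduction is compatible with the Higgs field: on `V_σ` the Higgs field takes values in the
Lie algebra of `P`. -/
def Reduction.IsCompatible {k : Type u} [Field k] {P G Z C : Sch k} [GrpObj P] [GrpObj G]
    {i : P ⟶ G} {E : HiggsFamily G Z C} (σ : Reduction i E) : Prop :=
  ∀ {R A : Type u} [CommRing R] [Algebra k R] [CommRing A] [Algebra k A]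
    (e : SqZeroExt (k := k) R A) (v : Pt R σ.tot) (τ : Pt A Z)
    (h : Pt.map e.retr τ = (v ≫ σ.incl) ≫ E.proj ≫ fst Z C),
    ∃ p : Pt A P, p ≫ i = E.θ e (v ≫ σ.incl) τ h

/-- The fibre product of `V_σ` and of the frame bundle of the polarization. -/
abbrev Reduction.prod {k : Type u} [Field k] {P G Z C : Sch k} [GrpObj P] [GrpObj G]
    {i : P ⟶ G} {E : HiggsFamily G Z C} (σ : Reduction i E) (H : Polarization Z) : Sch k :=
  pullback (σ.proj ≫ fst Z C) H.proj

/-- The global sections of the line bundle `χ_*(V_σ) ⊗ H ^ n`, as the functions `f` on the fibre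
product of `V_σ` and `W` with `f(v p, w s) = χ(p)⁻¹ s ^ (-n) f(v, w)`. -/
def Reduction.sections {k : Type u} [Field k] {P G Z C : Sch k} [GrpObj P] [GrpObj G]
    {i : P ⟶ G} {E : HiggsFamily G Z C} (σ : Reduction i E) (H : Polarization Z)
    (χ : P ⟶ Gm k) (n : ℕ) : Set Γ((σ.prod H).left, ⊤) :=
  {f | ∀ (R : Type u) [CommRing R] [Algebra k R] (x y : Pt R (σ.prod H)) (p : Pt R P)
    (s : Pt R (Gm k)),
    y ≫ pullback.fst _ _ = lift (x ≫ pullback.fst _ _) p ≫ σ.act →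
    y ≫ pullback.snd _ _ = lift (x ≫ pullback.snd _ _) s ≫ H.act →
    Pt.eval y f * Gm.coord (p ≫ χ) * Gm.coord s ^ n = Pt.eval x f}

/-- The dimension over `K` of the space of global sections of `χ_*(V_σ) ⊗ H ^ n`, for a Higgs
bundle over the base change of `Z` to `K`. -/
def Reduction.h0 {k : Type u} [Field k] {P G Z : Sch k} [GrpObj P] [GrpObj G]
    {i : P ⟶ G} {K : Type u} [Field K] [Algebra k K] {E : HiggsFamily G Z (specOver k K)}
    (σ : Reduction i E) (H : Polarization Z) (χ : P ⟶ Gm k) (n : ℕ) : ℕ :=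
  letI : Module K Γ((σ.prod H).left, ⊤) :=
    ((Scheme.ΓSpecIso (CommRingCat.of K)).inv ≫
      (pullback.fst (σ.proj ≫ fst Z (specOver k K)) H.proj ≫ σ.proj ≫
        snd Z (specOver k K)).left.appTop).hom.toModule
  Set.finrank K (σ.sections H χ n)

/-- The line bundle `L = χ_*(V_σ)` has degree `δ` with respect to the polarization `H` of the
`d`-dimensional variety `Z`. By asymptotic Riemann-Roch,
`h⁰(L ⊗ H ^ n) - h⁰(H ^ n) = (L · H ^ (d - 1)) n ^ (d - 1) / (d - 1)! + O(n ^ (d - 2))`. -/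
def Reduction.HasDegree {k : Type u} [Field k] {P G Z : Sch k} [GrpObj P] [GrpObj G]
    {i : P ⟶ G} {K : Type u} [Field K] [Algebra k K] {E : HiggsFamily G Z (specOver k K)}
    (σ : Reduction i E) (d : ℕ) (H : Polarization Z) (χ : P ⟶ Gm k) (δ : ℝ) : Prop :=
  Tendsto (fun n : ℕ => ((σ.h0 H χ n : ℝ) - (σ.h0 H 1 n : ℝ)) *
    (Nat.factorial (d - 1) : ℝ) / (n : ℝ) ^ (d - 1)) atTop (𝓝 δ)

/-- Ramanathan stability of a Higgs bundle over the base change of `Z` to a field `K`. It is used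
for split reductive `G` over `k`, where each parabolic subgroup over `K` is conjugate to one that
is defined over `k`, so that only the latter have to be considered. -/
def IsRStable {k : Type u} [Field k] {G Z : Sch k} [GrpObj G] (d : ℕ) (H : Polarization Z)
    {K : Type u} [Field K] [Algebra k K] (E : HiggsFamily G Z (specOver k K)) : Prop :=
  ∀ (P : Sch k) [GrpObj P] (i : P ⟶ G), IsParabolic i → ¬ IsIso i →
    ∀ σ : Reduction i E, σ.IsCompatible →
      ∀ χ : P ⟶ Gm k, IsMonHom χ → IsAntidominant i χ → IsTrivialOnCenter χ → χ ≠ 1 →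
        ∃ δ : ℝ, 0 < δ ∧ σ.HasDegree d H χ δ

/-- A family of Higgs bundles is `R`-stable if its geometric fibres are. -/
def HiggsFamily.IsRStableFamily {k : Type u} [Field k] {G Z C : Sch k} [GrpObj G]
    (E : HiggsFamily G Z C) (d : ℕ) (H : Polarization Z) : Prop :=
  ∀ (K : Type u) [Field K] [Algebra k K] [IsAlgClosed K] (c : Pt K C)
    (E' : HiggsFamily G Z (specOver k K)), IsPullbackOf E' E c → IsRStable d H E'

/-! ### Rigidity -/

/-- A family `F` on a positive-dimensional geometrically irreducible scheme `C` of finite type is a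
nontrivial deformation of `E` if there are two points `c₀`, `c₁` of `C` over a finite extension
`k'` of `k` such that the fibre at `c₀` is isomorphic to `E` over `k'`, and the fibres at `c₀` and
`c₁` are not isomorphic over the algebraic closure of `k`. -/
def IsNontrivialDeformation {k : Type u} [Field k] {G Z C : Sch k} [GrpObj G]
    (E : HiggsBundle G Z) (F : HiggsFamily G Z C) : Prop :=
  LocallyOfFiniteType C.hom ∧ QuasiCompact C.hom ∧ GeometricallyIrreducible C.hom ∧
  0 < topologicalKrullDim C.left ∧
  ∃ (k' : Type u) (_ : Field k') (_ : Algebra k k') (_ : FiniteDimensional k k')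
    (c₀ c₁ : Pt k' C),
    (∃ E₀ : HiggsFamily G Z (specOver k k'),
      IsPullbackOf E₀ E (toUnit _) ∧ IsPullbackOf E₀ F c₀) ∧
    ¬ ∃ E₁ : HiggsFamily G Z (specOver k (AlgebraicClosure k')),
      IsPullbackOf E₁ F (Pt.map (IsScalarTower.toAlgHom k k' (AlgebraicClosure k')) c₀) ∧
      IsPullbackOf E₁ F (Pt.map (IsScalarTower.toAlgHom k k' (AlgebraicClosure k')) c₁)

/-- A `G`-Higgs bundle is rigid if it is (geometrically) `R`-stable and has no nontrivial
deformation among `R`-stable `G`-Higgs bundles. -/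
def HiggsFamily.IsRigid {k : Type u} [Field k] {G Z : Sch k} [GrpObj G]
    (E : HiggsBundle G Z) (d : ℕ) (H : Polarization Z) : Prop :=
  E.IsRStableFamily d H ∧
  ∀ (C : Sch k) (F : HiggsFamily G Z C), F.IsRStableFamily d H → ¬ IsNontrivialDeformation E F

end GHiggs

end

/-!
Let `(V, θ)` be a rigid Higgs bundle. Multiplying the Higgs field by the coordinate `s` of the
multiplicative group gives a family `(V, s θ)` over this curve. A reduction of structure group is
compatible with `θ` if it is compatible with a unit multiple of `θ`, and degrees do not involve the
Higgs field, so the family is `R`-stable (`HiggsFamily.IsRStableFamily.scale_const`). Its fibre at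
`s = 1` is `(V, θ)`. By rigidity, the fibre at every point `s = a` over a finite extension of `k`
is isomorphic to `(V, θ)` over the algebraic closure
(`HiggsFamily.IsRigid.exists_isPullbackOf`).

Hence, for a representation `ρ` of rank `N` and a tangent vector `τ`, the matrices `dρ(θ(τ))` and
`a dρ(θ(τ))` are conjugate after a flat covering, and they have the same characteristic polynomial.
If `a ^ i ≠ 1` for `1 ≤ i ≤ N`, then this polynomial is `X ^ N`, because its coefficient of degree
`N - i` is multiplied by `a ^ i` and `a ^ i - 1` is invertible
(`Matrix.charpoly_eq_X_pow_of_charpoly_smul_eq`). By Cayley-Hamilton, `dρ(θ(τ)) ^ N` vanishes on the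
covering. It then vanishes over the ring one started with, by flat descent
(`eq_zero_of_flat_cover`), even if this ring is not reduced.

The condition `θ ∧ θ = 0` says that the matrices `dρ(θ(τ))` for varying `τ` commute
(`HiggsFamily.commute_deriv`). Their span is therefore an abelian Lie algebra of nilpotent matrices.

In the functorial description of `θ`, multiplication by a function is composition with the
homothety of a square-zero extension `R ⊕ M` that multiplies `M` by this function
(`SqZeroExt.homothety`).
-/

noncomputable section

namespace GHiggs

variable {k : Type u} [Field k]

/-! ### Points with values in algebras -/

section Points

variable {R S T : Type u} [CommRing R] [Algebra k R] [CommRing S] [Algebra k S] [CommRing T]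
  [Algebra k T]

lemma specOverMap_id : specOverMap (AlgHom.id k R) = 𝟙 _ := by
  ext : 1
  exact Spec.map_id _

lemma specOverMap_comp (f : R →ₐ[k] S) (g : S →ₐ[k] T) :
    specOverMap (g.comp f) = specOverMap g ≫ specOverMap f := by
  ext : 1
  exact Spec.map_comp (CommRingCat.ofHom f.toRingHom) (CommRingCat.ofHom g.toRingHom)

lemma Pt.map_id {X : Sch k} (x : Pt R X) : Pt.map (AlgHom.id k R) x = x := by
  rw [Pt.map, specOverMap_id, Category.id_comp]

lemma Pt.map_comp {X : Sch k} (f : R →ₐ[k] S) (g : S →ₐ[k] T) (x : Pt R X) :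
    Pt.map (g.comp f) x = Pt.map g (Pt.map f x) := by
  rw [Pt.map, specOverMap_comp, Category.assoc]

lemma Pt.map_mul {G : Sch k} [GrpObj G] (f : R →ₐ[k] S) (x y : Pt R G) :
    Pt.map f (x * y) = Pt.map f x * Pt.map f y :=
  MonObj.comp_mul _ _ _

lemma Pt.map_one {G : Sch k} [GrpObj G] (f : R →ₐ[k] S) : Pt.map f (1 : Pt R G) = 1 :=
  MonObj.comp_one _

lemma Pt.map_inv {G : Sch k} [GrpObj G] (f : R →ₐ[k] S) (x : Pt R G) :
    Pt.map f x⁻¹ = (Pt.map f x)⁻¹ :=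
  GrpObj.comp_inv _ _

lemma Pt.eval_map {X : Sch k} (f : R →ₐ[k] S) (x : Pt R X) (a : Γ(X.left, ⊤)) :
    Pt.eval (Pt.map f x) a = f (Pt.eval x a) := by
  rw [Pt.eval, Over.comp_left, Scheme.Hom.comp_appTop]
  exact congr($(Scheme.ΓSpecIso_naturality (CommRingCat.ofHom f.toRingHom)) (x.left.appTop a))

lemma Pt.eval_comp {X Y : Sch k} (x : Pt R X) (f : X ⟶ Y) (a : Γ(Y.left, ⊤)) :
    Pt.eval (x ≫ f) a = Pt.eval x (f.left.appTop a) := by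
  rw [Pt.eval, Over.comp_left, Scheme.Hom.comp_appTop]
  rfl

lemma Pt.eval_specOverMap (f : R →ₐ[k] S) (r : R) :
    Pt.eval (specOverMap f) ((Scheme.ΓSpecIso (CommRingCat.of R)).inv r) = f r := by
  have := congr($(Scheme.ΓSpecIso_naturality (CommRingCat.ofHom f.toRingHom))
    ((Scheme.ΓSpecIso (CommRingCat.of R)).inv r))
  refine this.trans ?_
  simp

/-- Every morphism of affine `k`-schemes comes from a homomorphism of `k`-algebras. -/
lemma exists_eq_specOverMap (q : specOver k S ⟶ specOver k R) :
    ∃ f : R →ₐ[k] S, specOverMap f = q := by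
  let φ := Spec.preimage q.left
  have hφ : CommRingCat.ofHom (algebraMap k R) ≫ φ = CommRingCat.ofHom (algebraMap k S) := by
    apply Spec.map_injective
    rw [Spec.map_comp, Spec.map_preimage]
    exact Over.w q
  refine ⟨⟨φ.hom, fun r => congr($hφ r)⟩, ?_⟩
  ext : 1
  exact Spec.map_preimage q.left

/-- Vanishing of a function on an affine scheme may be checked on the affine schemes over a flat
covering, which need not be quasi-compact. -/
lemma eq_zero_of_flat_cover {Y : Sch k} (p : Y ⟶ specOver k R) [Flat p.left]
    [Surjective p.left] (r : R)
    (h : ∀ (S : Type u) [CommRing S] [Algebra k S] (f : R →ₐ[k] S) (y : Pt S Y),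
      y ≫ p = specOverMap f → f r = 0) : r = 0 := by
  have : Epi p.left := Flat.epi_of_flat_of_surjective _
  let a (c : R) : CommRingCat.of (Polynomial R) ⟶ CommRingCat.of R :=
    CommRingCat.ofHom (Polynomial.evalRingHom c)
  -- functions on `Spec R` are sections of the affine line
  suffices Spec.map (a r) = Spec.map (a 0) by
    have := Spec.map_injective this
    simpa [a] using congr($this (Polynomial.X : Polynomial R))
  rw [← cancel_epi p.left]
  refine Y.left.affineCover.hom_ext _ _ fun i => ?_
  let S := Γ(Y.left.affineCover.X i, ⊤)
  let j : Spec S ⟶ Y.left := (Scheme.isoSpec _).inv ≫ Y.left.affineCover.f i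
  let φ := Spec.preimage (j ≫ Y.hom)
  let : Algebra k S := φ.hom.toAlgebra
  let y : Pt S Y := Over.homMk j (Spec.map_preimage (j ≫ Y.hom)).symm
  obtain ⟨f, hf⟩ := exists_eq_specOverMap (y ≫ p)
  have h0 := h S f y hf.symm
  rw [← cancel_epi (Scheme.isoSpec (Y.left.affineCover.X i)).inv]
  have hj : (Scheme.isoSpec (Y.left.affineCover.X i)).inv ≫ Y.left.affineCover.f i ≫ p.left
      = Spec.map (CommRingCat.ofHom f.toRingHom) := by
    have := congr(($hf).left)
    simpa [y, j, specOverMap] using this.symm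
  rw [← Category.assoc (Y.left.affineCover.f i), ← Category.assoc, hj,
    ← Category.assoc (Y.left.affineCover.f i), ← Category.assoc, hj, ← Spec.map_comp,
    ← Spec.map_comp]
  congr 1
  ext : 1
  refine Polynomial.ringHom_ext (fun c => ?_) ?_
  · simp [a]
  · simpa [a] using h0

end Points

/-! ### Homotheties of square-zero extensions -/

section SqZeroExt

variable {R A : Type u} [CommRing R] [Algebra k R] [CommRing A] [Algebra k A]

/-- Multiplication by `r` on the kernel `M` of a split square-zero extension `A = R ⊕ M`, as an
endomorphism of `A`. -/
def SqZeroExt.homothety (e : SqZeroExt (k := k) R A) (r : R) : A →ₐ[k] A where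
  toFun a := e.incl (e.retr a) + e.incl r * (a - e.incl (e.retr a))
  map_one' := by simp
  map_zero' := by simp
  map_add' a b := by simp only [map_add]; ring
  map_mul' a b := by
    have h := e.sq_zero (a - e.incl (e.retr a)) (b - e.incl (e.retr b))
      (by simp [e.retr_incl]) (by simp [e.retr_incl])
    simp only [map_mul]
    linear_combination (e.incl r - e.incl r ^ 2) * h
  commutes' c := by simp

lemma SqZeroExt.homothety_apply (e : SqZeroExt (k := k) R A) (r : R) (a : A) :
    e.homothety r a = e.incl (e.retr a) + e.incl r * (a - e.incl (e.retr a)) :=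
  rfl

lemma SqZeroExt.homothety_one (e : SqZeroExt (k := k) R A) : e.homothety 1 = AlgHom.id k A := by
  ext a
  simp [homothety_apply]

lemma SqZeroExt.homothety_comp (e : SqZeroExt (k := k) R A) (r s : R) :
    (e.homothety r).comp (e.homothety s) = e.homothety (r * s) := by
  ext a
  simp only [AlgHom.comp_apply, homothety_apply, map_add, map_mul, map_sub, e.retr_incl]
  ring

lemma SqZeroExt.retr_comp_homothety (e : SqZeroExt (k := k) R A) (r : R) :
    e.retr.comp (e.homothety r) = e.retr := by
  ext a
  simp [homothety_apply, e.retr_incl]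

lemma SqZeroExt.homothety_comp_incl (e : SqZeroExt (k := k) R A) (r : R) :
    (e.homothety r).comp e.incl = e.incl := by
  ext a
  simp [homothety_apply, e.retr_incl]

lemma SqZeroExt.comp_homothety {R' A' : Type u} [CommRing R'] [Algebra k R'] [CommRing A']
    [Algebra k A'] (e : SqZeroExt (k := k) R A) (e' : SqZeroExt (k := k) R' A')
    (f : R →ₐ[k] R') (F : A →ₐ[k] A') (hi : F.comp e.incl = e'.incl.comp f)
    (hr : e'.retr.comp F = f.comp e.retr) (r : R) :
    F.comp (e.homothety r) = (e'.homothety (f r)).comp F := by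
  have hi' (x) : F (e.incl x) = e'.incl (f x) := congr($hi x)
  have hr' (x) : e'.retr (F x) = f (e.retr x) := congr($hr x)
  ext a
  simp [homothety_apply, hi', hr']

end SqZeroExt

/-! ### Scaled and constant families of Higgs bundles -/

section Families

variable {G Z C : Sch k} [GrpObj G]

/-- The Higgs family `(V, s θ)` for a family `(V, θ)` over `C` and a global function `s` on `C`. -/
def HiggsFamily.scale (E : HiggsFamily G Z C) (s : Γ(C.left, ⊤)) : HiggsFamily G Z C where
  tot := E.tot
  proj := E.proj
  act := E.act
  torsor := E.torsor
  θ e v τ h := Pt.map (e.homothety (Pt.eval (v ≫ E.proj ≫ snd Z C) s)) (E.θ e v τ h)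
  θ_lie e v τ h := by
    rw [← Pt.map_comp, e.retr_comp_homothety, E.θ_lie]
  θ_natural e e' f F hi hr v τ h h' := by
    rw [E.θ_natural e e' f F hi hr v τ h h', ← Pt.map_comp, ← Pt.map_comp,
      e.comp_homothety e' f F hi hr, Category.assoc, Pt.eval_map]
  θ_equivariant e v g τ h h' := by
    rw [E.θ_equivariant e v g τ h h', Pt.map_mul, Pt.map_mul, Pt.map_inv, ← Pt.map_comp,
      e.homothety_comp_incl, ← Category.assoc _ E.proj, E.torsor.act_proj, Category.assoc]
  θ_integrable e₁ e₂ v τ₁ τ₂ h₁ h₂ f₁ f₂ hf := by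
    rw [← Pt.map_comp, ← Pt.map_comp]
    refine E.θ_integrable e₁ e₂ v τ₁ τ₂ h₁ h₂ _ _ ?_
    rw [AlgHom.comp_assoc, e₁.homothety_comp_incl, AlgHom.comp_assoc, e₂.homothety_comp_incl, hf]

/-- The product of a morphism with a scheme is a base change of it. -/
lemma isPullback_whiskerRight_left {X Y : Sch k} (p : X ⟶ Y) (C : Sch k) :
    IsPullback (fst X C).left (p ▷ C).left p.left (fst Y C).left := by
  have : IsPullback (fst X C) (p ▷ C) p (fst Y C) := by
    refine ⟨⟨by simp⟩, ⟨PullbackCone.IsLimit.mk _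
      (fun s => lift s.fst (s.snd ≫ snd Y C)) (by simp) (fun s => ?_) (fun s m h₁ h₂ => ?_)⟩⟩
    · ext1
      · simpa using s.condition
      · simp
    · ext1
      · simpa using h₁
      · simp [← h₂]
  exact this.map (Over.forget _)

/-- The constant family with parameter scheme `C` attached to a Higgs bundle `(V, θ)`. The parameter
scheme of the Higgs bundle itself is the unit, so its base is `Z ⊗ 𝟙_` and not `Z`. -/
def HiggsFamily.const (E : HiggsBundle G Z) (C : Sch k) : HiggsFamily G Z C where
  tot := E.tot ⊗ C
  proj := (E.proj ≫ fst Z (𝟙_ _)) ▷ C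
  act := lift (lift (fst _ _ ≫ fst _ _) (snd _ _) ≫ E.act) (fst _ _ ≫ snd _ _)
  torsor :=
    { act_one T v := by
        ext1
        · simpa [comp_lift_assoc] using E.torsor.act_one T (v ≫ fst _ _)
        · simp
      act_mul T v g h := by
        ext1
        · simpa [comp_lift_assoc] using E.torsor.act_mul T (v ≫ fst _ _) g h
        · simp
      act_proj T v g := by
        have := congr($(E.torsor.act_proj T (v ≫ fst _ _) g) ≫ fst _ _)
        ext1
        · simpa [comp_lift_assoc] using this
        · simp
      simply_transitive T v w h := by
        have h1 := congr($h ≫ fst _ _)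
        have h2 := congr($h ≫ snd _ _)
        obtain ⟨g, hg, hu⟩ := E.torsor.simply_transitive T (v ≫ fst _ _) (w ≫ fst _ _) (by
          ext1
          · simpa [comp_lift_assoc] using h1
          · exact toUnit_unique _ _)
        refine ⟨g, ?_, fun g' hg' => hu g' ?_⟩
        · ext1
          · simpa [comp_lift_assoc] using hg
          · simpa [comp_lift_assoc] using h2
        · simpa [comp_lift_assoc] using congr($hg' ≫ fst _ _)
      locally_trivial := by
        obtain ⟨U, p, s, hp, hp', hs⟩ := E.torsor.locally_trivial
        have hiso : IsIso (fst Z (𝟙_ (Sch k))) := by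
          rw [← rightUnitor_hom]; infer_instance
        have hiso' : IsIso (fst Z (𝟙_ (Sch k))).left :=
          inferInstanceAs (IsIso ((Over.forget _).map (fst Z (𝟙_ (Sch k)))))
        have h1 : Etale (p ≫ fst Z (𝟙_ _)).left := by
          rw [Over.comp_left]; infer_instance
        have h2 : Surjective (p ≫ fst Z (𝟙_ _)).left := by
          rw [Over.comp_left]; infer_instance
        have hpb := isPullback_whiskerRight_left (p ≫ fst Z (𝟙_ _)) C
        refine ⟨U ⊗ C, (p ≫ fst Z (𝟙_ _)) ▷ C, s ▷ C,
          MorphismProperty.of_isPullback hpb h1,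
          MorphismProperty.of_isPullback (P := @Surjective) hpb h2, ?_⟩
        rw [← hs]
        simp }
  θ e v τ h := E.θ e (v ≫ fst _ _) τ (by simpa [comp_lift_assoc] using h)
  θ_lie e v τ h := E.θ_lie e _ τ _
  θ_natural e e' f F hi hr v τ h h' :=
    E.θ_natural e e' f F hi hr (v ≫ fst _ _) τ (by simpa using h) (by simpa using h')
  θ_equivariant e v g τ h h' := by
    have := E.θ_equivariant e (v ≫ fst _ _) g τ (by simpa using h)
      (by simpa [comp_lift_assoc] using h')
    convert! this using 2
    simp [comp_lift_assoc]
  θ_integrable e₁ e₂ v τ₁ τ₂ h₁ h₂ f₁ f₂ hf := E.θ_integrable e₁ e₂ _ τ₁ τ₂ _ _ f₁ f₂ hf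

end Families

/-! ### Stability under scaling -/

section Stability

variable {G Z C : Sch k} [GrpObj G]

/-- A reduction of the structure group of `(V, θ)` is also one of `(V, s θ)`. -/
def Reduction.scale {P : Sch k} [GrpObj P] {i : P ⟶ G} {E : HiggsFamily G Z C}
    (σ : Reduction i E) (s : Γ(C.left, ⊤)) : Reduction i (E.scale s) where
  tot := σ.tot
  proj := σ.proj
  act := σ.act
  torsor := σ.torsor
  incl := σ.incl
  incl_proj := σ.incl_proj
  incl_act := σ.incl_act

lemma Reduction.IsCompatible.scale {P : Sch k} [GrpObj P] {i : P ⟶ G} {E : HiggsFamily G Z C}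
    {σ : Reduction i E} (hσ : σ.IsCompatible) (s : Γ(C.left, ⊤)) :
    (σ.scale s).IsCompatible := by
  intro R A _ _ _ _ e v τ h
  obtain ⟨p, hp⟩ := hσ e v τ h
  refine ⟨Pt.map (e.homothety (Pt.eval ((v ≫ σ.incl) ≫ E.proj ≫ snd Z C) s)) p, ?_⟩
  rw [Pt.map, Category.assoc, hp]
  rfl

/-- The reductions compatible with `θ` are among those compatible with `s θ`, and the degree
does not involve the Higgs field. -/
lemma IsRStable.of_scale {d : ℕ} {H : Polarization Z} {K : Type u} [Field K] [Algebra k K]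
    {E : HiggsFamily G Z (specOver k K)} (s : Γ((specOver k K).left, ⊤))
    (hE : IsRStable d H (E.scale s)) : IsRStable d H E :=
  fun P _ i hi hi' σ hσ χ hχ hχ' hχ'' hne =>
    hE P i hi hi' (σ.scale s) (hσ.scale s) χ hχ hχ' hχ'' hne

end Stability

/-! ### Fibres of scaled families -/

section Pullback

variable {G Z C C' C'' : Sch k} [GrpObj G]

lemma IsPullbackOf.trans {E'' : HiggsFamily G Z C''} {E' : HiggsFamily G Z C'}
    {E : HiggsFamily G Z C} {f : C'' ⟶ C'} {g : C' ⟶ C} (h : IsPullbackOf E'' E' f)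
    (h' : IsPullbackOf E' E g) : IsPullbackOf E'' E (f ≫ g) := by
  obtain ⟨φ, hφ, hφa, hφθ⟩ := h
  obtain ⟨ψ, hψ, hψa, hψθ⟩ := h'
  refine ⟨φ ≫ ψ, ?_, ?_, fun e v τ h₁ h₂ => ?_⟩
  · rw [Category.assoc, hψ, reassoc_of% hφ, whiskerLeft_comp]
  · rw [reassoc_of% hφa, hψa, comp_whiskerRight, Category.assoc]
  · have h₃ : Pt.map e.retr τ = (v ≫ φ) ≫ E'.proj ≫ fst Z C' := by
      rw [h₁, Category.assoc, reassoc_of% hφ, whiskerLeft_fst]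
    rw [← hφθ e v τ h₁ h₃, ← hψθ e (v ≫ φ) τ h₃ (by simpa using h₂)]
    simp only [Category.assoc]

lemma IsPullbackOf.scale {E' : HiggsFamily G Z C'} {E : HiggsFamily G Z C} {f : C' ⟶ C}
    (h : IsPullbackOf E' E f) (s : Γ(C.left, ⊤)) :
    IsPullbackOf (E'.scale (f.left.appTop s)) (E.scale s) f := by
  obtain ⟨φ, hφ, hφa, hφθ⟩ := h
  refine ⟨φ, hφ, hφa, fun {R A} _ _ _ _ e (v : Pt R E'.tot) τ h₁ h₂ => ?_⟩
  change Pt.map (e.homothety (Pt.eval ((v ≫ φ) ≫ E.proj ≫ snd Z C) s)) (E.θ e (v ≫ φ) τ h₂) =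
    Pt.map (e.homothety (Pt.eval (v ≫ E'.proj ≫ snd Z C') (f.left.appTop s))) (E'.θ e v τ h₁)
  rw [hφθ e v τ h₁ h₂, ← Pt.eval_comp, Category.assoc, reassoc_of% hφ]
  simp

lemma isPullbackOf_scale_of_eq_one (E : HiggsFamily G Z C) {s : Γ(C.left, ⊤)} (hs : s = 1) :
    IsPullbackOf (E.scale s) E (𝟙 C) := by
  subst hs
  refine ⟨𝟙 E.tot, ?_, ?_, fun {R A} _ _ _ _ e (v : Pt R E.tot) τ h₁ h₂ => ?_⟩
  · change 𝟙 E.tot ≫ E.proj = E.proj ≫ Z ◁ 𝟙 C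
    simp
  · change E.act ≫ 𝟙 E.tot = (𝟙 E.tot ▷ G) ≫ E.act
    simp
  · change E.θ e (v ≫ 𝟙 E.tot) τ h₂ =
      Pt.map (e.homothety (Pt.eval (v ≫ E.proj ≫ snd Z C) 1)) (E.θ e v τ h₁)
    rw [Pt.eval, _root_.map_one, _root_.map_one, e.homothety_one, Pt.map_id]
    simp

lemma isPullbackOf_scale_scale (E : HiggsFamily G Z C) (s t : Γ(C.left, ⊤)) :
    IsPullbackOf ((E.scale s).scale t) (E.scale (t * s)) (𝟙 C) := by
  refine ⟨𝟙 E.tot, ?_, ?_, fun {R A} _ _ _ _ e (v : Pt R E.tot) τ h₁ h₂ => ?_⟩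
  · change 𝟙 E.tot ≫ E.proj = E.proj ≫ Z ◁ 𝟙 C
    simp
  · change E.act ≫ 𝟙 E.tot = (𝟙 E.tot ▷ G) ≫ E.act
    simp
  · change Pt.map (e.homothety (Pt.eval ((v ≫ 𝟙 E.tot) ≫ E.proj ≫ snd Z C) (t * s)))
        (E.θ e (v ≫ 𝟙 E.tot) τ h₂) =
      Pt.map (e.homothety (Pt.eval (v ≫ E.proj ≫ snd Z C) t))
        (Pt.map (e.homothety (Pt.eval (v ≫ E.proj ≫ snd Z C) s)) (E.θ e v τ h₁))
    rw [← Pt.map_comp, e.homothety_comp]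
    simp only [Category.comp_id, Pt.eval, map_mul]

lemma isPullbackOf_const (E : HiggsBundle G Z) (f : C' ⟶ C) :
    IsPullbackOf (E.const C') (E.const C) f := by
  refine ⟨E.tot ◁ f, ?_, ?_, fun {R A} _ _ _ _ e (v : Pt R (E.tot ⊗ C')) τ h₁ h₂ => ?_⟩
  · exact whisker_exchange _ _
  · change lift (lift (fst _ _ ≫ fst _ _) (snd _ _) ≫ E.act) (fst _ _ ≫ snd _ _) ≫ E.tot ◁ f =
      ((E.tot ◁ f) ▷ G) ≫ lift (lift (fst _ _ ≫ fst _ _) (snd _ _) ≫ E.act) (fst _ _ ≫ snd _ _)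
    ext1 <;> simp [comp_lift_assoc]
  · change E.θ e ((v ≫ E.tot ◁ f) ≫ fst _ _) τ _ = E.θ e (v ≫ fst _ _) τ _
    simp only [Category.assoc, whiskerLeft_fst]

lemma isPullbackOf_const_toUnit (E : HiggsBundle G Z) (C : Sch k) :
    IsPullbackOf (E.const C) E (toUnit C) := by
  refine ⟨fst _ _, ?_, ?_, fun e v τ h h' => rfl⟩
  · change fst _ _ ≫ E.proj = ((E.proj ≫ fst Z (𝟙_ _)) ▷ C) ≫ _
    ext1
    · simp
    · exact toUnit_unique _ _
  · change lift (lift (fst _ _ ≫ fst _ _) (snd _ _) ≫ E.act) (fst _ _ ≫ snd _ _) ≫ fst _ _ =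
      (fst _ _ ▷ G) ≫ E.act
    rw [lift_fst]
    congr 1

/-- If `s` is invertible, then the fibres of `(V, s θ)` become fibres of `(V, θ)` after scaling by
the inverse of the value of `s`, so that they are stable. -/
lemma HiggsFamily.IsRStableFamily.scale_const {d : ℕ} {H : Polarization Z} {E : HiggsBundle G Z}
    (hE : E.IsRStableFamily d H) {s t : Γ(C.left, ⊤)} (hst : t * s = 1) :
    ((E.const C).scale s).IsRStableFamily d H := by
  intro K _ _ _ c E' hE'
  exact IsRStable.of_scale (c.left.appTop t) <| hE K _ _ <|
    ((((hE'.scale t).trans (isPullbackOf_scale_scale _ s t)).trans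
      (isPullbackOf_scale_of_eq_one _ hst)).trans (isPullbackOf_const_toUnit E C))

end Pullback

/-! ### Nilpotent matrices -/

section Matrices

variable {R : Type u} [CommRing R] {N : ℕ}

lemma _root_.Matrix.coeff_charpolyRev_smul (t : R) (M : Matrix (Fin N) (Fin N) R) (i : ℕ) :
    (t • M).charpolyRev.coeff i = M.charpolyRev.coeff i * t ^ i := by
  have : (t • M).charpolyRev = M.charpolyRev.comp (Polynomial.C t * Polynomial.X) := by
    rw [Matrix.charpolyRev, Matrix.charpolyRev, ← Polynomial.coe_compRingHom_apply,
      RingHom.map_det]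
    congr 1
    ext a b : 1
    by_cases hab : a = b <;> simp [hab] <;> ring
  rw [this, Polynomial.comp_C_mul_X_coeff]

/-- If `M` and `t • M` have the same characteristic polynomial and all `t ^ i - 1` are invertible,
then this polynomial is `X ^ N`. -/
lemma _root_.Matrix.charpoly_eq_X_pow_of_charpoly_smul_eq {t : R} {M : Matrix (Fin N) (Fin N) R}
    (h : (t • M).charpoly = M.charpoly) (ht : ∀ i, 1 ≤ i → i ≤ N → IsUnit (t ^ i - 1)) :
    M.charpoly = Polynomial.X ^ N := by
  nontriviality R
  have h' : (t • M).charpolyRev = M.charpolyRev := by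
    rw [← Matrix.reverse_charpoly, ← Matrix.reverse_charpoly, h]
  ext i
  rcases lt_trichotomy i N with hi | rfl | hi
  · have h1 := congr(Polynomial.coeff $h' (N - i))
    have h2 : M.charpoly.coeff i = M.charpolyRev.coeff (N - i) := by
      rw [← Matrix.reverse_charpoly, Polynomial.coeff_reverse, Matrix.charpoly_natDegree_eq_dim,
        Fintype.card_fin, Polynomial.revAt_le (by omega)]
      congr 1
      omega
    rw [Matrix.coeff_charpolyRev_smul] at h1
    rw [h2, Polynomial.coeff_X_pow, if_neg hi.ne,
      ← (ht (N - i) (by omega) (by omega)).mul_left_eq_zero]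
    linear_combination h1
  · have := M.charpoly_monic.coeff_natDegree
    rw [Matrix.charpoly_natDegree_eq_dim, Fintype.card_fin] at this
    simp [this]
  · rw [Polynomial.coeff_eq_zero_of_natDegree_lt, Polynomial.coeff_X_pow, if_neg hi.ne']
    rwa [Matrix.charpoly_natDegree_eq_dim, Fintype.card_fin]

attribute [local instance] LieRing.ofAssociativeRing in
/-- The span of a set of commuting nilpotent matrices is an abelian Lie algebra that consists of
nilpotent matrices. -/
lemma exists_nilpotent_lieSubalgebra (s : Set (Matrix (Fin N) (Fin N) R))
    (hs : ∀ X ∈ s, ∀ Y ∈ s, Commute X Y) (hn : ∀ X ∈ s, _root_.IsNilpotent X) :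
    ∃ 𝔫 : LieSubalgebra R (Matrix (Fin N) (Fin N) R),
      LieRing.IsNilpotent 𝔫 ∧ (∀ X ∈ 𝔫, _root_.IsNilpotent X) ∧ s ⊆ 𝔫 := by
  have hcomm : ∀ X ∈ Submodule.span R s, ∀ Y ∈ Submodule.span R s, Commute X Y := by
    intro X hX Y hY
    induction hX, hY using Submodule.span_induction₂ with
    | mem_mem x y hx hy => exact hs x hx y hy
    | zero_left => exact Commute.zero_left _
    | zero_right => exact Commute.zero_right _
    | add_left _ _ _ _ _ _ h₁ h₂ => exact h₁.add_left h₂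
    | add_right _ _ _ _ _ _ h₁ h₂ => exact h₁.add_right h₂
    | smul_left r _ _ _ _ h => exact h.smul_left r
    | smul_right r _ _ _ _ h => exact h.smul_right r
  let 𝔫 : LieSubalgebra R (Matrix (Fin N) (Fin N) R) :=
    { Submodule.span R s with
      lie_mem' := fun {X Y} hX hY => by
        rw [Ring.lie_def, (hcomm X hX Y hY).eq, sub_self]
        exact Submodule.zero_mem _ }
  refine ⟨𝔫, ?_, fun X hX => ?_, Submodule.subset_span⟩
  · have : IsLieAbelian 𝔫 := ⟨fun X Y => by
      ext1
      exact (Ring.lie_def _ _).trans (sub_eq_zero.2 (hcomm X X.2 Y Y.2).eq)⟩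
    infer_instance
  · change X ∈ Submodule.span R s at hX
    induction hX using Submodule.span_induction with
    | mem x hx => exact hn x hx
    | zero => exact IsNilpotent.zero
    | add x y hx hy h₁ h₂ => exact (hcomm x hx y hy).isNilpotent_add h₁ h₂
    | smul r x _ h => exact h.smul r

end Matrices

/-! ### Derivatives of representations -/

section Derivative

variable {R S : Type u} [CommRing R] [Algebra k R] [CommRing S] [Algebra k S]

variable (k) in
/-- Functoriality of the dual numbers. -/
def dualMap (f : R →ₐ[k] S) : DualNumber R →ₐ[k] DualNumber S where
  toFun a := .inl (f a.fst) + .inr (f a.snd)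
  map_one' := by ext <;> simp
  map_mul' a b := by ext <;> simp
  map_zero' := by ext <;> simp
  map_add' a b := by ext <;> simp
  commutes' c := by ext <;> simp [TrivSqZeroExt.algebraMap_eq_inl']

lemma dualMap_comp_incl (f : R →ₐ[k] S) :
    (dualMap k f).comp (SqZeroExt.dual k R).incl = (SqZeroExt.dual k S).incl.comp f := by
  ext a <;> simp [dualMap, SqZeroExt.dual]

lemma retr_comp_dualMap (f : R →ₐ[k] S) :
    (SqZeroExt.dual k S).retr.comp (dualMap k f) = f.comp (SqZeroExt.dual k R).retr := by
  ext a <;> simp [dualMap, SqZeroExt.dual]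

variable {G : Sch k} [GrpObj G] {N : ℕ} (ρ : Rep G N)

lemma Rep.deriv_dualMap (f : R →ₐ[k] S) (x : Pt (DualNumber R) G) :
    ρ.deriv (Pt.map (dualMap k f) x) = (ρ.deriv x).map f := by
  rw [Rep.deriv, ρ.natural]
  ext a b
  simp [Rep.deriv, dualMap]

lemma Rep.deriv_homothety (r : R) (x : Pt (DualNumber R) G) :
    ρ.deriv (Pt.map ((SqZeroExt.dual k R).homothety r) x) = r • ρ.deriv x := by
  rw [Rep.deriv, ρ.natural]
  ext a b
  simp [Rep.deriv, SqZeroExt.homothety_apply, SqZeroExt.dual]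

lemma Rep.charpoly_deriv_conj (g : Pt R G) (x : Pt (DualNumber R) G) :
    (ρ.deriv ((Pt.map (SqZeroExt.dual k R).incl g)⁻¹ * x *
      Pt.map (SqZeroExt.dual k R).incl g)).charpoly = (ρ.deriv x).charpoly := by
  have : ρ.deriv ((Pt.map (SqZeroExt.dual k R).incl g)⁻¹ * x *
      Pt.map (SqZeroExt.dual k R).incl g) =
      (↑(ρ.toHom R g)⁻¹ : Matrix (Fin N) (Fin N) R) * ρ.deriv x * (ρ.toHom R g).1 := by
    rw [← Pt.map_inv, Rep.deriv, _root_.map_mul, _root_.map_mul, ρ.natural, ρ.natural,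
      _root_.map_inv]
    have hl (A : Matrix (Fin N) (Fin N) R) (M : Matrix (Fin N) (Fin N) (DualNumber R)) :
        (A.map TrivSqZeroExt.inl * M).map TrivSqZeroExt.snd = A * M.map TrivSqZeroExt.snd := by
      ext a b
      simp [Matrix.mul_apply, TrivSqZeroExt.snd_sum]
    have hr (A : Matrix (Fin N) (Fin N) R) (M : Matrix (Fin N) (Fin N) (DualNumber R)) :
        (M * A.map TrivSqZeroExt.inl).map TrivSqZeroExt.snd = M.map TrivSqZeroExt.snd * A := by
      ext a b
      simp [Matrix.mul_apply, TrivSqZeroExt.snd_sum, mul_comm]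
    exact (hr (ρ.toHom R g).1 _).trans (congrArg (· * (ρ.toHom R g).1) (hl _ _))
  rw [this, Matrix.charpoly_mul_comm, ← _root_.mul_assoc, Units.mul_inv, _root_.one_mul]

/-- This is `ρ(x) = 1 + ε dρ(x)`. -/
lemma Rep.eq_one_add (x : Pt (DualNumber R) G) (hx : Pt.map (SqZeroExt.dual k R).retr x = 1) :
    (ρ.toHom (DualNumber R) x).1 =
      1 + (ρ.deriv x).map (TrivSqZeroExt.inr : R → DualNumber R) := by
  have := ρ.natural _ _ (SqZeroExt.dual k R).retr x
  rw [hx, _root_.map_one] at this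
  have h (a b) : (1 : Matrix (Fin N) (Fin N) R) a b =
    ((ρ.toHom (DualNumber R) x).1 a b).fst := congr(($this).1 a b)
  ext a b
  · by_cases hab : a = b <;> simp [← h, hab]
  · by_cases hab : a = b <;> simp [Rep.deriv, hab]

end Derivative

/-! ### The multiplicative group as a parameter scheme -/

section Laurent

instance geometricallyIrreducible_laurent :
    GeometricallyIrreducible (specOver k (LaurentPolynomial k)).hom := by
  rw [GeometricallyIrreducible.eq_geometrically, geometrically_iff_of_isClosedUnderIsomorphisms]
  intro K _ y
  obtain ⟨ψ, rfl⟩ := Spec.map_surjective y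
  let : Algebra k K := ψ.hom.toAlgebra
  have : IrreducibleSpace (Spec (CommRingCat.of (TensorProduct k (LaurentPolynomial k) K))) := by
    have e : TensorProduct k (LaurentPolynomial k) K ≃+* LaurentPolynomial K :=
      (Algebra.TensorProduct.comm k _ _).toRingEquiv.trans
        (AddMonoidAlgebra.scalarTensorEquiv k K).toRingEquiv
    have : IsDomain (TensorProduct k (LaurentPolynomial k) K) := e.toMulEquiv.isDomain _
    exact PrimeSpectrum.irreducibleSpace (R := TensorProduct k (LaurentPolynomial k) K)
  exact (pullbackSpecIso k (LaurentPolynomial k) K).hom.homeomorph.irreducibleSpace_iff.2 this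

lemma topologicalKrullDim_laurent_pos :
    0 < topologicalKrullDim (specOver k (LaurentPolynomial k)).left := by
  have : topologicalKrullDim (specOver k (LaurentPolynomial k)).left =
    ringKrullDim (LaurentPolynomial k) := PrimeSpectrum.topologicalKrullDim_eq_ringKrullDim _
  rw [this, lt_iff_le_and_ne]
  refine ⟨ringKrullDim_nonneg_of_nontrivial, fun h => ?_⟩
  have := ringKrullDimZero_iff_ringKrullDim_eq_zero.2 h.symm
  have hf : IsField (LaurentPolynomial k) := Ring.KrullDimLE.isField_of_isDomain
  let := hf.toField
  -- a field has only injective homomorphisms to a field, but evaluation at `1` kills `T - 1`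
  have h1 : LaurentPolynomial.eval₂ (RingHom.id k) 1 (.T 1) =
      LaurentPolynomial.eval₂ (RingHom.id k) 1 1 := by simp
  have h2 := (LaurentPolynomial.eval₂ (RingHom.id k) 1).injective h1
  have h3 := congr(LaurentPolynomial.degree $h2)
  rw [← LaurentPolynomial.T_zero] at h3
  simp [-LaurentPolynomial.T_zero] at h3

instance locallyOfFiniteType_laurent :
    LocallyOfFiniteType (specOver k (LaurentPolynomial k)).hom := by
  refine (HasRingHomProperty.Spec_iff (P := @LocallyOfFiniteType)).2 ?_
  have : Algebra.FiniteType k (LaurentPolynomial k) := inferInstance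
  exact RingHom.finiteType_algebraMap.2 this

/-- Evaluation of Laurent polynomials at a unit. -/
def laurentEval {R : Type u} [CommRing R] [Algebra k R] (a : Rˣ) :
    LaurentPolynomial k →ₐ[k] R where
  toRingHom := LaurentPolynomial.eval₂ (algebraMap k R) a
  commutes' _ := LaurentPolynomial.eval₂_C _ _ _

lemma laurentEval_T {R : Type u} [CommRing R] [Algebra k R] (a : Rˣ) :
    laurentEval (k := k) a (.T 1) = a :=
  (LaurentPolynomial.eval₂_T (algebraMap k R) a 1).trans (by simp)

end Laurent

/-! ### Nilpotency from an isomorphism between scaled fibres -/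

section Nilpotency

variable {G Z C : Sch k} [GrpObj G]

/-- This expresses `θ ∧ θ = 0` in terms of matrices. -/
lemma HiggsFamily.commute_deriv (E : HiggsFamily G Z C) {N : ℕ} (ρ : Rep G N) {R : Type u}
    [CommRing R] [Algebra k R] (v : Pt R E.tot) (τ₁ τ₂ : Pt (DualNumber R) Z)
    (h₁ : Pt.map (SqZeroExt.dual k R).retr τ₁ = v ≫ E.proj ≫ fst Z C)
    (h₂ : Pt.map (SqZeroExt.dual k R).retr τ₂ = v ≫ E.proj ≫ fst Z C) :
    Commute (ρ.deriv (E.θ (SqZeroExt.dual k R) v τ₁ h₁))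
      (ρ.deriv (E.θ (SqZeroExt.dual k R) v τ₂ h₂)) := by
  -- `f₁` and `f₂` send the generator of `R[ε]` to the two generators of `R[ε₁][ε₂]`
  let f₁ : DualNumber R →ₐ[k] DualNumber (DualNumber R) := (SqZeroExt.dual k (DualNumber R)).incl
  let f₂ : DualNumber R →ₐ[k] DualNumber (DualNumber R) := dualMap k (SqZeroExt.dual k R).incl
  have hf : f₁.comp (SqZeroExt.dual k R).incl = f₂.comp (SqZeroExt.dual k R).incl :=
    (dualMap_comp_incl _).symm
  have h := (E.θ_integrable (S := DualNumber (DualNumber R)) (SqZeroExt.dual k R)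
    (SqZeroExt.dual k R) v τ₁ τ₂ h₁ h₂ f₁ f₂ hf).map (ρ.toHom _)
  have h' := congrArg Units.val h.eq
  rw [ρ.natural, ρ.natural] at h'
  set X := ρ.deriv (E.θ (SqZeroExt.dual k R) v τ₁ h₁) with hX
  set Y := ρ.deriv (E.θ (SqZeroExt.dual k R) v τ₂ h₂) with hY
  have hX' := ρ.eq_one_add _ (E.θ_lie (SqZeroExt.dual k R) v τ₁ h₁)
  have hY' := ρ.eq_one_add _ (E.θ_lie (SqZeroExt.dual k R) v τ₂ h₂)
  rw [← hX] at hX'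
  rw [← hY] at hY'
  let p : Matrix (Fin N) (Fin N) (DualNumber (DualNumber R)) → Matrix (Fin N) (Fin N) R :=
    fun M => M.map fun a => a.snd.snd
  change (ρ.toHom _ _).1.map f₁ * (ρ.toHom _ _).1.map f₂ =
    (ρ.toHom _ _).1.map f₂ * (ρ.toHom _ _).1.map f₁ at h'
  rw [hX', hY'] at h'
  have e₁ : (1 + X.map (TrivSqZeroExt.inr : R → DualNumber R)).map f₁ =
      1 + X.map fun a => TrivSqZeroExt.inl (TrivSqZeroExt.inr a) := by
    ext a b : 1
    by_cases hab : a = b <;> simp [hab, f₁, SqZeroExt.dual]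
  have e₂ : (1 + Y.map (TrivSqZeroExt.inr : R → DualNumber R)).map f₂ =
      1 + Y.map fun a => TrivSqZeroExt.inr (TrivSqZeroExt.inl a) := by
    ext a b : 1
    by_cases hab : a = b <;> simp [hab, f₂, dualMap, SqZeroExt.dual]
  rw [e₁, e₂] at h'
  -- the coefficients of `ε₁ ε₂`
  have h3 := congrArg p h'
  ext a b
  have h4 := congr($h3 a b)
  simp only [p, _root_.mul_add, _root_.add_mul, _root_.mul_one, _root_.one_mul,
    Matrix.map_apply, Matrix.add_apply, TrivSqZeroExt.snd_add] at h4
  simpa [Matrix.mul_apply, TrivSqZeroExt.snd_sum, Matrix.one_apply, apply_ite, mul_comm]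
    using h4

/-- The characteristic polynomial of `dρ(θ(τ))` depends only on `τ`, since two trivializations over
the same point of `Z` differ by an element of `G`. -/
lemma HiggsFamily.charpoly_deriv_eq (E : HiggsBundle G Z) {N : ℕ} (ρ : Rep G N) {R : Type u}
    [CommRing R] [Algebra k R] (v w : Pt R E.tot) (τ : Pt (DualNumber R) Z)
    (hv : Pt.map (SqZeroExt.dual k R).retr τ = v ≫ E.proj ≫ fst Z _)
    (hw : Pt.map (SqZeroExt.dual k R).retr τ = w ≫ E.proj ≫ fst Z _) :
    (ρ.deriv (E.θ (SqZeroExt.dual k R) v τ hv)).charpoly =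
      (ρ.deriv (E.θ (SqZeroExt.dual k R) w τ hw)).charpoly := by
  obtain ⟨g, rfl, -⟩ := E.torsor.simply_transitive _ w v (by
    ext1
    · simpa using hw.symm.trans hv
    · exact toUnit_unique _ _)
  rw [E.θ_equivariant _ w g τ hw hv, ρ.charpoly_deriv_conj]

/-- If the fibres of `(V, s θ)` at two points where `s` has the values `1` and `a` are isomorphic,
then `θ` is nilpotent, because a frame of the fibre exhibits `θ` and `a θ` as conjugate. -/
lemma HiggsFamily.deriv_pow_eq_zero (E : HiggsBundle G Z) (s : Γ(C.left, ⊤)) {L : Type u}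
    [Field L] [Algebra k L] {c₀ c₁ : Pt L C} {E₁ : HiggsFamily G Z (specOver k L)}
    (h₀ : IsPullbackOf E₁ ((E.const C).scale s) c₀) (h₁ : IsPullbackOf E₁ ((E.const C).scale s) c₁)
    {N : ℕ} (hc₀ : Pt.eval c₀ s = 1) (hc₁ : ∀ i, 1 ≤ i → i ≤ N → Pt.eval c₁ s ^ i ≠ 1)
    (ρ : Rep G N) {R : Type u} [CommRing R] [Algebra k R] (v : Pt R E.tot)
    (τ : Pt (DualNumber R) Z)
    (h : Pt.map (SqZeroExt.dual k R).retr τ = v ≫ E.proj ≫ fst Z _) :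
    ρ.deriv (E.θ (SqZeroExt.dual k R) v τ h) ^ N = 0 := by
  obtain ⟨U, p, σ, hp, hp', hσ⟩ := E₁.torsor.locally_trivial
  -- the frames of `E₁` over `U` give a flat covering of `Z`
  have : Flat (specOver k L).hom := by dsimp; infer_instance
  have : Surjective (specOver k L).hom := by
    dsimp; exact ⟨Function.surjective_to_subsingleton _⟩
  have : Flat (fst Z (specOver k L)).left := by rw [Over.fst_left]; infer_instance
  have : Surjective (fst Z (specOver k L)).left := by rw [Over.fst_left]; infer_instance
  have hq : Flat (p ≫ fst Z (specOver k L)).left := by rw [Over.comp_left]; infer_instance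
  have hq' : Surjective (p ≫ fst Z (specOver k L)).left := by
    rw [Over.comp_left]; infer_instance
  let z : Pt R Z := v ≫ E.proj ≫ fst Z _
  let Y : Sch k := Over.mk (pullback.snd (p ≫ fst Z (specOver k L)).left z.left ≫
    (specOver k R).hom)
  let pY : Y ⟶ specOver k R := Over.homMk (pullback.snd _ _) rfl
  let qY : Y ⟶ U := Over.homMk (pullback.fst (p ≫ fst Z (specOver k L)).left z.left) (by
    rw [← Over.w (p ≫ fst Z (specOver k L)), pullback.condition_assoc, Over.w z]
    rfl)
  have hY : qY ≫ p ≫ fst Z (specOver k L) = pY ≫ z := by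
    ext : 1
    exact pullback.condition
  have : Flat pY.left := inferInstanceAs (Flat (pullback.snd _ _))
  have : Surjective pY.left := inferInstanceAs (Surjective (pullback.snd _ _))
  ext a b
  refine eq_zero_of_flat_cover pY _ fun S _ _ f y hy => ?_
  obtain ⟨φ₀, hφ₀, -, hθ₀⟩ := h₀
  obtain ⟨φ₁, hφ₁, -, hθ₁⟩ := h₁
  let w : Pt S E₁.tot := y ≫ qY ≫ σ
  let τ' : Pt (DualNumber S) Z := Pt.map (dualMap k f) τ
  have hτ : Pt.map (SqZeroExt.dual k S).retr τ' = Pt.map f v ≫ E.proj ≫ fst Z _ := by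
    rw [← Pt.map_comp, retr_comp_dualMap, Pt.map_comp, h]
    simp only [Category.assoc]
  have hw : w ≫ E₁.proj ≫ fst Z _ = Pt.map f v ≫ E.proj ≫ fst Z _ := by
    have : Pt.map f v ≫ E.proj ≫ fst Z _ = y ≫ pY ≫ z := by
      rw [← Category.assoc y, hy, Category.assoc]
    rw [this, ← hY]
    simp only [w, Category.assoc, reassoc_of% hσ]
  obtain ⟨g, hg⟩ := exists_eq_specOverMap (w ≫ E₁.proj ≫ snd _ _)
  -- an isomorphism of `E₁` with the fibre at `c` maps the frame `w` of `E₁` to a frame `w'` of `E`,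
  -- and the Higgs field of `E₁` in the frame `w` is that of `E` in the frame `w'`, times `s(c)`
  have key (c : Pt L C) (φ : E₁.tot ⟶ E.tot ⊗ C)
      (hφ : φ ≫ ((E.proj ≫ fst Z (𝟙_ _)) ▷ C) = E₁.proj ≫ Z ◁ c)
      (hθ : ∀ (h₁ : Pt.map (SqZeroExt.dual k S).retr τ' = w ≫ E₁.proj ≫ fst Z _)
        (h₂ : Pt.map (SqZeroExt.dual k S).retr τ' =
          (w ≫ φ) ≫ ((E.proj ≫ fst Z (𝟙_ _)) ▷ C) ≫ fst Z _),
        ((E.const C).scale s).θ (SqZeroExt.dual k S) (w ≫ φ) τ' h₂ =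
          E₁.θ (SqZeroExt.dual k S) w τ' h₁) :
      ∃ (w' : Pt S E.tot)
        (h' : Pt.map (SqZeroExt.dual k S).retr τ' = w' ≫ E.proj ≫ fst Z _),
        ρ.deriv (E₁.θ (SqZeroExt.dual k S) w τ' (hτ.trans hw.symm)) =
        g (Pt.eval c s) • ρ.deriv (E.θ (SqZeroExt.dual k S) w' τ' h') := by
    have h1 : (w ≫ φ) ≫ ((E.proj ≫ fst Z (𝟙_ _)) ▷ C) ≫ fst Z _ = w ≫ E₁.proj ≫ fst Z _ := by
      rw [Category.assoc, reassoc_of% hφ, whiskerLeft_fst]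
    have h2 : ((w ≫ φ) ≫ fst _ _) ≫ E.proj ≫ fst Z _ =
        (w ≫ φ) ≫ ((E.proj ≫ fst Z (𝟙_ _)) ▷ C) ≫ fst Z _ := by
      simp
    have h3 : (w ≫ φ) ≫ ((E.proj ≫ fst Z (𝟙_ _)) ▷ C) ≫ snd Z _ = Pt.map g c := by
      rw [Category.assoc, reassoc_of% hφ, whiskerLeft_snd, Pt.map, hg]
      simp only [Category.assoc]
    refine ⟨(w ≫ φ) ≫ fst _ _, (hτ.trans hw.symm).trans (h1.symm.trans h2.symm), ?_⟩
    rw [← hθ _ ((hτ.trans hw.symm).trans h1.symm), ← ρ.deriv_homothety, ← Pt.eval_map, ← h3]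
    rfl
  obtain ⟨w₀, h₀', hM₀⟩ := key c₀ φ₀ hφ₀ (hθ₀ _ w τ')
  obtain ⟨w₁, h₁', hM₁⟩ := key c₁ φ₁ hφ₁ (hθ₁ _ w τ')
  rw [hc₀, _root_.map_one, one_smul] at hM₀
  have hn : (ρ.deriv (E.θ (SqZeroExt.dual k S) w₁ τ' h₁')).charpoly =
      Polynomial.X ^ N := by
    refine Matrix.charpoly_eq_X_pow_of_charpoly_smul_eq (t := g (Pt.eval c₁ s)) ?_
      fun i hi hi' => ?_
    · rw [← hM₁, hM₀]
      exact E.charpoly_deriv_eq ρ _ _ _ _ _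
    · rw [← _root_.map_pow, ← _root_.map_one g, ← _root_.map_sub]
      exact (sub_ne_zero.2 (hc₁ i hi hi')).isUnit.map g
  -- pass from the frame `w₁` to the pullback of the given frame `v`
  rw [← E.charpoly_deriv_eq ρ (Pt.map f v) _ τ' hτ,
    E.θ_natural _ _ f (dualMap k f) (dualMap_comp_incl f) (retr_comp_dualMap f) v τ h,
    ρ.deriv_dualMap] at hn
  have hM := Matrix.aeval_self_charpoly
    ((ρ.deriv (E.θ (SqZeroExt.dual k R) v τ h)).map f)
  rw [hn, _root_.map_pow, Polynomial.aeval_X] at hM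
  have hf := _root_.map_pow f.toRingHom.mapMatrix (ρ.deriv (E.θ (SqZeroExt.dual k R) v τ h)) N
  exact congr($(hf.trans hM) a b)

end Nilpotency

/-! ### Rigidity -/

/-- The finite extension is needed only when `k` has too few elements. -/
lemma exists_isUnit_finite_extension (k : Type u) [Field k] (N : ℕ) :
    ∃ (k' : Type u) (_ : Field k') (_ : Algebra k k') (_ : FiniteDimensional k k') (a : k'ˣ),
      ∀ i, 1 ≤ i → i ≤ N → (a : k') ^ i ≠ 1 := by
  -- an element of the algebraic closure that is not a root of `p` is nonzero and its powers with
  -- exponents up to `N`, all of which divide `N!`, differ from `1`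
  let p : Polynomial (AlgebraicClosure k) := Polynomial.X ^ (N.factorial + 1) - Polynomial.X
  have hp : p ≠ 0 := by
    have hN := N.factorial_ne_zero
    intro h
    have := congr(Polynomial.coeff $h 1)
    simp [p, Polynomial.coeff_X_pow, hN] at this
  classical
  obtain ⟨a, ha⟩ := Infinite.exists_notMem_finset p.roots.toFinset
  replace ha : a ^ (N.factorial + 1) ≠ a := by
    simpa [hp, p, sub_eq_zero] using ha
  have ha0 : a ≠ 0 := by
    rintro rfl
    simp at ha
  let a' : IntermediateField.adjoin k {a} := IntermediateField.AdjoinSimple.gen k a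
  have ha' : a' ≠ 0 := fun h => ha0 (congrArg Subtype.val h)
  refine ⟨IntermediateField.adjoin k {a}, inferInstance, inferInstance,
    IntermediateField.adjoin.finiteDimensional (Algebra.IsIntegral.isIntegral a),
    Units.mk0 a' ha', fun i hi hi' h => ha ?_⟩
  have h' : a ^ i = 1 := congrArg Subtype.val h
  obtain ⟨m, hm⟩ := Nat.dvd_factorial hi hi'
  rw [pow_succ, hm, pow_mul, h', one_pow, _root_.one_mul]

section Rigid

variable {G Z : Sch k} [GrpObj G] {d : ℕ} {H : Polarization Z} {E : HiggsBundle G Z}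

/-- If `(V, θ)` is rigid and `s` is an invertible function on a positive-dimensional scheme `C`,
then the fibre of `(V, s θ)` at a point where `s` has the value `1` is geometrically isomorphic to
all other fibres over the same finite extension of `k`. -/
lemma HiggsFamily.IsRigid.exists_isPullbackOf (hE : E.IsRigid d H) {C : Sch k}
    [LocallyOfFiniteType C.hom] [QuasiCompact C.hom] [GeometricallyIrreducible C.hom]
    (hC : 0 < topologicalKrullDim C.left) {s t : Γ(C.left, ⊤)} (hts : t * s = 1) {k' : Type u}
    [Field k'] [Algebra k k'] [FiniteDimensional k k'] (c₀ c₁ : Pt k' C)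
    (hc₀ : Pt.eval c₀ s = 1) :
    ∃ E₁ : HiggsFamily G Z (specOver k (AlgebraicClosure k')),
      IsPullbackOf E₁ ((E.const C).scale s)
        (Pt.map (IsScalarTower.toAlgHom k k' (AlgebraicClosure k')) c₀) ∧
      IsPullbackOf E₁ ((E.const C).scale s)
        (Pt.map (IsScalarTower.toAlgHom k k' (AlgebraicClosure k')) c₁) := by
  have hone : c₀.left.appTop s = 1 := by
    apply (Scheme.ΓSpecIso (CommRingCat.of k')).commRingCatIsoToRingEquiv.injective
    rw [_root_.map_one]
    exact hc₀
  have h₁ := (isPullbackOf_scale_of_eq_one (E.const (specOver k k')) hone).trans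
    (isPullbackOf_const_toUnit E _)
  rw [Category.id_comp] at h₁
  have h₂ := (isPullbackOf_const E c₀).scale s
  by_contra hne
  refine hE.2 C _ (hE.1.scale_const hts) ⟨inferInstance, inferInstance, inferInstance, hC, ?_⟩
  exact ⟨k', _, _, inferInstance, c₀, c₁, ⟨_, h₁, h₂⟩, hne⟩

/-- The family used here is `(V, s θ)` over the multiplicative group with coordinate `s`, and its
fibres at `1` and at a point `a` with `a ^ i ≠ 1` for `1 ≤ i ≤ N`. -/
lemma HiggsFamily.IsRigid.deriv_pow_eq_zero (hE : E.IsRigid d H) {N : ℕ} (ρ : Rep G N)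
    {R : Type u} [CommRing R] [Algebra k R] (v : Pt R E.tot) (τ : Pt (DualNumber R) Z)
    (h : Pt.map (SqZeroExt.dual k R).retr τ = v ≫ E.proj ≫ fst Z _) :
    ρ.deriv (E.θ (SqZeroExt.dual k R) v τ h) ^ N = 0 := by
  obtain ⟨k', _, _, _, a, ha⟩ := exists_isUnit_finite_extension k N
  let C : Sch k := specOver k (LaurentPolynomial k)
  let j := Scheme.ΓSpecIso (CommRingCat.of (LaurentPolynomial k))
  let s : Γ(C.left, ⊤) := j.inv (.T 1 : LaurentPolynomial k)
  let t : Γ(C.left, ⊤) := j.inv (.T (-1) : LaurentPolynomial k)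
  have hts : t * s = 1 := by
    refine (_root_.map_mul j.inv.hom _ _).symm.trans ?_
    rw [← LaurentPolynomial.T_add]
    simp
  have hev (b : k'ˣ) : Pt.eval (specOverMap (laurentEval (k := k) b)) s = b :=
    (Pt.eval_specOverMap _ _).trans (laurentEval_T b)
  have : QuasiCompact C.hom := by dsimp [C]; infer_instance
  obtain ⟨E₁, h₀, h₁⟩ := hE.exists_isPullbackOf topologicalKrullDim_laurent_pos hts
    (specOverMap (laurentEval 1)) (specOverMap (laurentEval a)) (by rw [hev, Units.val_one])
  refine E.deriv_pow_eq_zero s h₀ h₁ ?_ (fun i hi hi' => ?_) ρ v τ h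
  · rw [Pt.eval_map, hev, Units.val_one, _root_.map_one]
  · rw [Pt.eval_map, hev, ← _root_.map_pow]
    intro h
    exact ha i hi hi' ((algebraMap k' (AlgebraicClosure k')).injective
      (h.trans (_root_.map_one _).symm))

end Rigid

end GHiggs

end

theorem mainTheorem3 {k : Type u} [Field k] [PerfectField k]
    (G : GHiggs.Sch k) [GrpObj G] (hG : GHiggs.IsReductive G) (hGs : GHiggs.IsSplit G)
    (Z : GHiggs.Sch k) (d : ℕ) [IsIntegral Z.left] [IsProper Z.hom]
    [SmoothOfRelativeDimension d Z.hom] (H : GHiggs.Polarization Z)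
    (E : GHiggs.HiggsBundle G Z) (hE : E.IsRigid d H) :
    E.IsNilpotent := by
  intro N ρ R _ _ v
  obtain ⟨𝔫, h₁, h₂, h₃⟩ := GHiggs.exists_nilpotent_lieSubalgebra
    {X | ∃ τ h, X = ρ.deriv (E.θ (GHiggs.SqZeroExt.dual k R) v τ h)}
    (by
      rintro _ ⟨τ₁, h₁, rfl⟩ _ ⟨τ₂, h₂, rfl⟩
      exact E.commute_deriv ρ v τ₁ τ₂ h₁ h₂)
    (by
      rintro _ ⟨τ, h, rfl⟩
      exact ⟨N, hE.deriv_pow_eq_zero ρ v τ h⟩)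
  exact ⟨𝔫, h₁, h₂, fun τ h => h₃ ⟨τ, h, rfl⟩⟩
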